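/- Let $\Lambda$ be a $k$-graph, i.e. a countable small category with a degree functor $d:\Lambda\to\mathbb N^k$ such that every $\lambda$ with $d(\lambda)=m+n$ factors uniquely as $\lambda=\mu\nu$ with $d(\mu)=m$, $d(\nu)=n$. Assume that $\Lambda$ is finite ($\Lambda^n=\{\lambda : d(\lambda)=n\}$ is finite for every $n\in\mathbb N^k$) and has no sources (for every vertex $v$ and every $n$, the set $v\Lambda^n$ of paths of range $v$ and degree $n$ is non-empty). Let $\Lambda^\infty$ be its infinite path space, that is, the set of degree-preserving functors $x:\Omega_k\to\Lambda$, where $\Omega_k$ is the category with objects $\mathbb N^k$ and one morphism $(p,q)$ of degree $q-p$, range $p$ and source $q$, for each $p\le q$; give it the topology generated by the cylinder sets $Z(\lambda)=\{x: x(0,d(\lambda))=\lambda\}$ and the corresponding Borel $\sigma$-algebra. Let $\{t_\lambda\}_{\lambda\in\Lambda}$ be a representation of $C^*(\Lambda)$ on a separable complex Hilbert space $\mathcal H$, i.e. a family of partial isometries on $\mathcal H$ such that: the $t_v$ ($v$ a vertex) are mutually orthogonal projections; $t_\lambda t_\eta=t_{\lambda\eta}$ whenever $s(\lambda)=r(\eta)$;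 $t_\lambda^*t_\lambda=t_{s(\lambda)}$; and $t_v=\sum_{\lambda\in v\Lambda^n}t_\lambda t_\lambda^*$ for all vertices $v$ and all $n\in\mathbb N^k$. Suppose that $t_\lambda t_\lambda^*\neq0$ for all $\lambda\in\Lambda$. There is a unique projection valued measure $P$ on the Borel sets of $\Lambda^\infty$ (countably additive in the strong operator topology, $P(\Lambda^\infty)=\mathrm{Id}$ not being required) with $P(Z(\lambda))=t_\lambda t_\lambda^*$ for all $\lambda$. Suppose moreover that the representation is purely atomic: there is a Borel set $\Omega\subset\Lambda^\infty$ with $P(\Lambda^\infty\setminus\Omega)=0$, $P(\{\omega\})\ne0$ for all $\omega\in\Omega$, and $\sum_{\omega\in\Omega}P(\{\omega\})=\mathrm{Id}_{\mathcal H}$ in the strong operator topology. Then the representation is monic (that is, $t_\lambda\neq0$ for all $\lambda$, and there is a cyclic vector, i.e. $\xi\in\mathcal H$ with $\overline{\mathrm{span}}\{t_\lambda t_\lambda^*\xi:\lambda\in\Lambda\}=\mathcal H$) if and only if $P(\{x\})$ has one-dimensional range for every atom $x$, i.e. every $x\in\Lambda^\infty$ with $P(\{x\})\neq0$. Moreover,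 in this case, for every cyclic vector $\xi$ there is a unique Borel measure $\mu$ on $\Lambda^\infty$ with $\mu(Z(\lambda))=\langle\xi,t_\lambda t_\lambda^*\xi\rangle$ for all $\lambda$, and $\mu$ is atomic, i.e. concentrated on the points of positive measure: $\mu(\{x:\mu(\{x\})=0\})=0$. -/

import Mathlib

open CategoryTheory MeasureTheory

universe u

/-- A `k`-graph, presented on its small category `Λ` with object set `V`.
A path `λ` with source `s(λ) = v` and range `r(λ) = w` is a morphism `v ⟶ w`; the product `λη` of
paths with `s(λ) = r(η)` is the composite `η ≫ λ`; vertices are identified with identities. -/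
class KGraph (k : ℕ) (V : Type u) [SmallCategory V] where
  /-- there are countably many paths -/
  countable_paths : Countable (Arrow V)
  /-- the degree functor -/
  degree : ∀ {v w : V}, (v ⟶ w) → (Fin k → ℕ)
  degree_id : ∀ v : V, degree (𝟙 v) = 0
  degree_comp : ∀ {u v w : V} (g : u ⟶ v) (f : v ⟶ w), degree (g ≫ f) = degree f + degree g
  /-- the factorization property: if `d(λ) = m + n` then `λ = μν` for a unique pair of paths with
  `d(μ) = m` and `d(ν) = n` -/
  factorization : ∀ {v w : V} (f : v ⟶ w) (m n : Fin k → ℕ), degree f = m + n →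
    ∃! p : (Σ c : V, (c ⟶ w) × (v ⟶ c)),
      degree p.2.1 = m ∧ degree p.2.2 = n ∧ p.2.2 ≫ p.2.1 = f

namespace KGraph

section Basic

variable (k : ℕ) (V : Type u) [SmallCategory V] [KGraph k V]

/-- `Λ` is finite: `Λⁿ` is a finite set for every `n ∈ ℕᵏ`. -/
def IsFinite : Prop :=
  ∀ n : Fin k → ℕ, {f : Arrow V | degree (k := k) f.hom = n}.Finite

/-- `Λ` has no sources: `vΛⁿ` is non-empty for every vertex `v` and every `n ∈ ℕᵏ`. -/
def NoSources : Prop :=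
  ∀ (v : V) (n : Fin k → ℕ), ∃ (w : V) (f : w ⟶ v), degree f = n

/-- An infinite path: a degree preserving functor `x : Ω_k → Λ`. The category `Ω_k` has object set
`ℕᵏ` and exactly one morphism `(p, q)`, of range `p` and source `q`, whenever `p ≤ q`; its degree
is `q - p`. The functor sends `(p, q)` to the path `x(p, q)`, of range `x(p)` and source `x(q)`,
written `map h` with `h : p ≤ q`. -/
structure InfinitePath where
  obj : (Fin k → ℕ) → V
  map : ∀ {p q : Fin k → ℕ}, p ≤ q → (obj q ⟶ obj p)
  map_id : ∀ p : Fin k → ℕ, map (le_refl p) = 𝟙 (obj p)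
  map_comp : ∀ {p q r : Fin k → ℕ} (h : p ≤ q) (h' : q ≤ r), map h' ≫ map h = map (h.trans h')
  degree_map : ∀ {p q : Fin k → ℕ} (h : p ≤ q), degree (map h) = q - p

end Basic

section Paths

variable {k : ℕ} {V : Type u} [SmallCategory V] [KGraph k V]

/-- The set `vΛⁿ` of paths of range `v` and degree `n`. -/
def PathsTo (v : V) (n : Fin k → ℕ) : Type u :=
  {f : (Σ w : V, (w ⟶ v)) // degree f.2 = n}

/-- The initial segment `x(0, m)` of an infinite path, as an element of the set of all paths. -/
def InfinitePath.initial (x : InfinitePath k V) (m : Fin k → ℕ) : Arrow V :=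
  Arrow.mk (x.map (show 0 ≤ m from fun _ => Nat.zero_le _))

/-- The cylinder set `Z(λ) = {x : x(0, d(λ)) = λ}`. -/
def cylinder {v w : V} (f : v ⟶ w) : Set (InfinitePath k V) :=
  {x | x.initial (degree f) = Arrow.mk f}

/-- The topology on `Λ^∞` generated by the cylinder sets. -/
instance : TopologicalSpace (InfinitePath k V) :=
  TopologicalSpace.generateFrom {Z | ∃ (v w : V) (f : v ⟶ w), Z = cylinder f}

/-- The Borel `σ`-algebra of `Λ^∞`. -/
instance : MeasurableSpace (InfinitePath k V) := borel _

instance : BorelSpace (InfinitePath k V) := ⟨rfl⟩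

end Paths

end KGraph

/-- A projection valued measure on a measurable space `X` with values in the orthogonal projections
of a Hilbert space `H`, countably additive in the strong operator topology. The value at a set that
is not measurable is `0` by convention. It is not required that `P(X)` be the identity. -/
structure ProjectionValuedMeasure (X : Type*) [MeasurableSpace X] (H : Type*)
    [NormedAddCommGroup H] [InnerProductSpace ℂ H] [CompleteSpace H] where
  toFun : Set X → (H →L[ℂ] H)
  not_measurable : ∀ A, ¬ MeasurableSet A → toFun A = 0
  isStarProjection : ∀ A, MeasurableSet A → IsStarProjection (toFun A)
  empty : toFun ∅ = 0
  inter : ∀ A B, MeasurableSet A → MeasurableSet B → toFun (A ∩ B) = toFun A * toFun B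
  hasSum_iUnion : ∀ A : ℕ → Set X, (∀ i, MeasurableSet (A i)) →
    Pairwise (fun i j => Disjoint (A i) (A j)) →
    ∀ ξ : H, HasSum (fun i => toFun (A i) ξ) (toFun (⋃ i, A i) ξ)

/-- A projection valued measure is purely atomic if for some measurable `Ω` one has
`P(X \ Ω) = 0`, `P({ω}) ≠ 0` for all `ω ∈ Ω`, and `∑_{ω ∈ Ω} P({ω}) = Id` in the strong operator
topology. -/
def ProjectionValuedMeasure.IsPurelyAtomic {X : Type*} [MeasurableSpace X] {H : Type*}
    [NormedAddCommGroup H] [InnerProductSpace ℂ H] [CompleteSpace H]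
    (P : ProjectionValuedMeasure X H) : Prop :=
  ∃ Ω : Set X, MeasurableSet Ω ∧ P.toFun Ωᶜ = 0 ∧ (∀ ω ∈ Ω, P.toFun {ω} ≠ 0) ∧
    ∀ ξ : H, HasSum (fun ω : Ω => P.toFun {(ω : X)} ξ) ξ

/-- A measure is atomic if it is concentrated on the set of points of positive measure. -/
def IsAtomicMeasure {X : Type*} [MeasurableSpace X] (μ : Measure X) : Prop :=
  μ {x | μ {x} = 0} = 0

namespace KGraph

variable {k : ℕ} {V : Type u} [SmallCategory V] [KGraph k V]
variable {H : Type*} [NormedAddCommGroup H] [InnerProductSpace ℂ H] [CompleteSpace H]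

/-- A representation of `C*(Λ)` on `H` (for `Λ` row-finite without sources), that is, a
Cuntz-Krieger `Λ`-family of operators on `H`; `star` is the Hilbert space adjoint. -/
structure IsRepresentation (k : ℕ) {V : Type u} [SmallCategory V] [KGraph k V]
    {H : Type*} [NormedAddCommGroup H] [InnerProductSpace ℂ H] [CompleteSpace H]
    (t : ∀ {v w : V}, (v ⟶ w) → (H →L[ℂ] H)) : Prop where
  partial_isometry : ∀ {v w : V} (f : v ⟶ w), t f * star (t f) * t f = t f
  ck1_proj : ∀ v : V, IsStarProjection (t (𝟙 v))
  ck1_orth : ∀ v w : V, v ≠ w → t (𝟙 v) * t (𝟙 w) = 0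
  ck2 : ∀ {u v w : V} (f : v ⟶ w) (g : u ⟶ v), t f * t g = t (g ≫ f)
  ck3 : ∀ {v w : V} (f : v ⟶ w), star (t f) * t f = t (𝟙 v)
  ck4 : ∀ (v : V) (n : Fin k → ℕ),
    t (𝟙 v) = ∑ᶠ f : PathsTo v n, t f.1.2 * star (t f.1.2)

/-- `P` is the projection valued measure on `Λ^∞` of the family `t`: `P(Z(λ)) = t_λ t_λ^*`. -/
def IsProjectionValuedMeasureOf (t : ∀ {v w : V}, (v ⟶ w) → (H →L[ℂ] H))
    (P : ProjectionValuedMeasure (InfinitePath k V) H) : Prop :=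
  ∀ {v w : V} (f : v ⟶ w), P.toFun (cylinder f) = t f * star (t f)

/-- `ξ` is cyclic for the operators `t_λ t_λ^*`: the closed linear span of the vectors
`t_λ t_λ^* ξ` is `H`. -/
def IsCyclicVector (t : ∀ {v w : V}, (v ⟶ w) → (H →L[ℂ] H)) (ξ : H) : Prop :=
  (Submodule.span ℂ {η : H | ∃ (v w : V) (f : v ⟶ w), η = (t f * star (t f)) ξ}).topologicalClosure
    = ⊤

/-- The family `t` is monic: all `t_λ` are non-zero and there is a cyclic vector. -/
def IsMonic (t : ∀ {v w : V}, (v ⟶ w) → (H →L[ℂ] H)) : Prop :=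
  (∀ {v w : V} (f : v ⟶ w), t f ≠ 0) ∧ ∃ ξ : H, IsCyclicVector t ξ

/-- `μ` is the Borel measure on `Λ^∞` given by `t` and `ξ`: `μ(Z(λ)) = ⟨ξ, t_λ t_λ^* ξ⟩`. -/
def IsMeasureOf (t : ∀ {v w : V}, (v ⟶ w) → (H →L[ℂ] H)) (ξ : H)
    (μ : Measure (InfinitePath k V)) : Prop :=
  ∀ {v w : V} (f : v ⟶ w),
    μ (cylinder f) = ENNReal.ofReal (inner ℂ ξ ((t f * star (t f)) ξ)).re

end KGraph

/-! Write μ_ξ(A) = ‖P(A)ξ‖². If ξ is cyclic and x is an atom, then P({x}) t_λ t_λ^* ξ = P({x})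
P(Z(λ)) ξ is P({x})ξ or 0 according to whether x lies in Z(λ). So P({x}) maps a dense subspace,
hence all of H, into the line through P({x})ξ (`finrank_range_eq_one_of_isCyclicVector`).

Conversely, separability makes Ω countable, so a geometrically weighted sum of unit vectors from the
ranges of the atoms is a ξ with P({ω})ξ ≠ 0 for every ω in Ω. A point is the decreasing intersection
of the cylinders of its initial segments, so each P({ω})ξ lies in the closed span of the t_λ t_λ^* ξ
(`apply_singleton_mem_closure_span`). Rank one puts P({ω})η there for every η, and η is the sum of
these vectors. The measure attached to ξ is μ_ξ, which is carried by the countable set Ω and is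
therefore atomic.

The existence of P needs more work. By the last Cuntz-Krieger relation the weights ‖t_λ t_λ^* ξ‖²
are consistent under extension of paths. The path space is compact, and point-mass approximations
converge along an ultrafilter to a measure with these weights (`exists_measure_of_weights`). The
sets A for which μ_ξ(A) is the quadratic form of a projection are then shown, by a π-λ argument, to
be all Borel sets (`exists_of_isProjectionOfSet`). Uniqueness holds because cylinder values
determine each μ_ξ, and quadratic forms determine projections. -/

namespace IsStarProjection

/-! ### Projections and their quadratic forms. -/

variable {H : Type*} [NormedAddCommGroup H] [InnerProductSpace ℂ H] [CompleteSpace H]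

lemma apply_apply {e : H →L[ℂ] H} (he : IsStarProjection e) (ξ : H) : e (e ξ) = e ξ :=
  congrArg (fun T : H →L[ℂ] H => T ξ) he.isIdempotentElem.eq

lemma inner_apply_left {e : H →L[ℂ] H} (he : IsStarProjection e) (ξ η : H) :
    inner ℂ (e ξ) η = inner ℂ ξ (e η) :=
  he.isSelfAdjoint.isSymmetric ξ η

lemma inner_apply_self {e : H →L[ℂ] H} (he : IsStarProjection e) (ξ : H) :
    inner ℂ ξ (e ξ) = (‖e ξ‖ : ℂ) ^ 2 := by
  rw [← he.apply_apply, ← he.inner_apply_left, he.apply_apply, inner_self_eq_norm_sq_to_K]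
  rfl

lemma re_inner_apply_self {e : H →L[ℂ] H} (he : IsStarProjection e) (ξ : H) :
    (inner ℂ ξ (e ξ)).re = ‖e ξ‖ ^ 2 := by
  rw [he.inner_apply_self]
  norm_cast

lemma norm_apply_le {e : H →L[ℂ] H} (he : IsStarProjection e) (ξ : H) : ‖e ξ‖ ≤ ‖ξ‖ := by
  have h := he.re_inner_apply_self ξ
  have h2 : (inner ℂ ξ (e ξ)).re ≤ ‖ξ‖ * ‖e ξ‖ := re_inner_le_norm (𝕜 := ℂ) ξ (e ξ)
  by_contra! hlt
  nlinarith [norm_nonneg ξ]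

/-- Over ℂ an operator is determined by its quadratic form, which for a projection is ‖eξ‖². -/
lemma ext_of_norm {e f : H →L[ℂ] H} (he : IsStarProjection e) (hf : IsStarProjection f)
    (h : ∀ ξ, ‖e ξ‖ = ‖f ξ‖) : e = f := by
  refine (ext_inner_map _ _).1 ?_ |> fun h => ContinuousLinearMap.coe_injective h
  intro ξ
  change inner ℂ (e ξ) ξ = inner ℂ (f ξ) ξ
  rw [he.inner_apply_left, hf.inner_apply_left, he.inner_apply_self, hf.inner_apply_self, h]

lemma mul_eq_zero_of_norm {e f : H →L[ℂ] H} (hf : IsStarProjection f)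
    (h : ∀ ξ, ‖e ξ‖ ^ 2 + ‖f ξ‖ ^ 2 ≤ ‖ξ‖ ^ 2) : e * f = 0 := by
  ext ξ
  have h1 := h (f ξ)
  rw [hf.apply_apply] at h1
  have h2 : ‖e (f ξ)‖ ^ 2 ≤ 0 := by linarith
  have h3 : ‖e (f ξ)‖ = 0 := by nlinarith [norm_nonneg (e (f ξ))]
  simpa using h3

/-- The vector ξ - fξ is killed by f, hence by e. -/
lemma mul_eq_left_of_norm_le {e f : H →L[ℂ] H} (hf : IsStarProjection f)
    (h : ∀ ξ, ‖e ξ‖ ≤ ‖f ξ‖) : e * f = e := by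
  ext ξ
  have h1 := h (ξ - f ξ)
  rw [map_sub f, hf.apply_apply, sub_self, norm_zero, norm_le_zero_iff, map_sub] at h1
  exact (sub_eq_zero.1 h1).symm

lemma finset_sum {ι : Type*} {e : ι → H →L[ℂ] H} (F : Finset ι)
    (he : ∀ i ∈ F, IsStarProjection (e i))
    (horth : ∀ i ∈ F, ∀ j ∈ F, i ≠ j → e i * e j = 0) : IsStarProjection (∑ i ∈ F, e i) := by
  classical
  induction F using Finset.induction_on with
  | empty => simp
  | insert a F ha ih =>
    rw [Finset.sum_insert ha]
    refine (he a (Finset.mem_insert_self _ _)).add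
      (ih (fun i hi => he i (Finset.mem_insert_of_mem hi)) fun i hi j hj =>
        horth i (Finset.mem_insert_of_mem hi) j (Finset.mem_insert_of_mem hj)) ?_
    rw [Finset.mul_sum]
    refine Finset.sum_eq_zero fun i hi => horth a (Finset.mem_insert_self _ _) i
      (Finset.mem_insert_of_mem hi) ?_
    rintro rfl
    exact ha hi

lemma sum_norm_sq_le {ι : Type*} {e : ι → H →L[ℂ] H} (he : ∀ i, IsStarProjection (e i))
    (horth : Pairwise fun i j => e i * e j = 0) (F : Finset ι) (ξ : H) :
    ∑ i ∈ F, ‖e i ξ‖ ^ 2 ≤ ‖ξ‖ ^ 2 := by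
  have hE := finset_sum F (fun i _ => he i) fun i _ j _ hij => horth hij
  have h1 := hE.re_inner_apply_self ξ
  have h2 : (inner ℂ ξ ((∑ i ∈ F, e i) ξ)).re = ∑ i ∈ F, ‖e i ξ‖ ^ 2 := by
    rw [_root_.sum_apply, inner_sum, Complex.re_sum]
    exact Finset.sum_congr rfl fun i _ => (he i).re_inner_apply_self ξ
  rw [← h2, h1]
  exact pow_le_pow_left₀ (norm_nonneg _) (hE.norm_apply_le ξ) 2

/-- An orthogonal family of projections sums to a projection, in the strong operator topology. -/
lemma exists_hasSum {ι : Type*} {e : ι → H →L[ℂ] H} (he : ∀ i, IsStarProjection (e i))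
    (horth : Pairwise fun i j => e i * e j = 0) :
    ∃ T : H →L[ℂ] H, IsStarProjection T ∧ ∀ ξ, HasSum (fun i => e i ξ) (T ξ) := by
  classical
  have hV : OrthogonalFamily ℂ (fun i => (e i).range) fun i => (e i).range.subtypeₗᵢ := by
    intro i j hij
    rintro ⟨_, x, rfl⟩ ⟨_, y, rfl⟩
    change inner ℂ (e i x) (e j y) = 0
    rw [(he i).inner_apply_left]
    have : e i (e j y) = 0 := congrArg (fun T : H →L[ℂ] H => T y) (horth hij)
    rw [this, inner_zero_right]
  have hs : ∀ ξ, Summable fun i => e i ξ := by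
    intro ξ
    -- Orthogonality reduces convergence to summability of squared norms, which is Bessel's
    -- inequality.
    refine (hV.summable_iff_norm_sq_summable fun i => ⟨e i ξ, ξ, rfl⟩).2 ?_
    exact summable_of_sum_le (fun i => by positivity) fun F => sum_norm_sq_le he horth F ξ
  let T₀ : H →ₗ[ℂ] H :=
    { toFun := fun ξ => ∑' i, e i ξ
      map_add' := fun ξ η => by
        simp only [map_add]
        exact (hs ξ).tsum_add (hs η)
      map_smul' := fun c ξ => by
        simp only [map_smul, RingHom.id_apply]
        exact (hs ξ).tsum_const_smul c }
  have hT₀ : ∀ ξ, HasSum (fun i => e i ξ) (T₀ ξ) := fun ξ => (hs ξ).hasSum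
  have hbound : ∀ ξ, ‖T₀ ξ‖ ≤ 1 * ‖ξ‖ := by
    intro ξ
    rw [one_mul]
    refine le_of_tendsto (hT₀ ξ).norm (Filter.Eventually.of_forall fun F => ?_)
    have := (finset_sum F (fun i _ => he i) fun i _ j _ hij => horth hij).norm_apply_le ξ
    rwa [_root_.sum_apply] at this
  let T : H →L[ℂ] H := T₀.mkContinuous 1 hbound
  have hT : ∀ ξ, HasSum (fun i => e i ξ) (T ξ) := hT₀
  refine ⟨T, ⟨?_, ?_⟩, hT⟩
  · ext ξ
    have h1 : ∀ i, e i (T ξ) = e i ξ := by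
      intro i
      have h2 := (hT ξ).mapL (e i)
      refine h2.unique ?_
      have h3 : (fun j => e i (e j ξ)) = fun j => if j = i then e i ξ else 0 := by
        funext j
        split_ifs with hj
        · rw [hj, (he i).apply_apply]
        · exact congrArg (fun S : H →L[ℂ] H => S ξ) (horth (Ne.symm hj))
      rw [h3]
      exact hasSum_ite_eq i _
    have h4 := hT (T ξ)
    simp only [h1] at h4
    exact h4.unique (hT ξ)
  · rw [ContinuousLinearMap.isSelfAdjoint_iff_isSymmetric]
    intro ξ η
    have h1 : HasSum (fun i => inner ℂ (e i ξ) η) (inner ℂ (T ξ) η) := by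
      have := ((hT ξ).mapL (innerSL ℂ η)).map (starRingEnd ℂ) Complex.continuous_conj
      simpa [Function.comp_def] using this
    have h2 : HasSum (fun i => inner ℂ ξ (e i η)) (inner ℂ ξ (T η)) := (hT η).mapL (innerSL ℂ ξ)
    simp only [(he _).inner_apply_left] at h1
    exact h1.unique h2

end IsStarProjection

/-! ### Sets measured by projections. -/

/-- `e` is the projection whose quadratic form is `ξ ↦ μ_ξ(A)`. -/
def IsProjectionOfSet {X : Type*} [MeasurableSpace X] {H : Type*} [NormedAddCommGroup H]
    [InnerProductSpace ℂ H] [CompleteSpace H] (μ : H → Measure X) (A : Set X) (e : H →L[ℂ] H) :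
    Prop :=
  IsStarProjection e ∧ ∀ ξ, μ ξ A = ENNReal.ofReal (‖e ξ‖ ^ 2)

namespace IsProjectionOfSet

variable {X : Type*} [MeasurableSpace X] {H : Type*} [NormedAddCommGroup H]
  [InnerProductSpace ℂ H] [CompleteSpace H] {μ : H → Measure X} {A B : Set X} {e f : H →L[ℂ] H}

lemma unique (he : IsProjectionOfSet μ A e) (hf : IsProjectionOfSet μ A f) : e = f := by
  refine he.1.ext_of_norm hf.1 fun ξ => ?_
  have h := (he.2 ξ).symm.trans (hf.2 ξ)
  rw [ENNReal.ofReal_eq_ofReal_iff (by positivity) (by positivity)] at h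
  exact (pow_left_inj₀ (norm_nonneg _) (norm_nonneg _) two_ne_zero).1 h

/-- Additivity on A ∪ B and the bound on the total mass give ‖eξ‖² + ‖fξ‖² ≤ ‖ξ‖², which forces
orthogonality. -/
lemma mul_eq_zero (hμ : ∀ ξ, μ ξ Set.univ ≤ ENNReal.ofReal (‖ξ‖ ^ 2))
    (he : IsProjectionOfSet μ A e) (hf : IsProjectionOfSet μ B f) (hB : MeasurableSet B)
    (hAB : Disjoint A B) : e * f = 0 := by
  refine hf.1.mul_eq_zero_of_norm fun ξ => ?_
  have h : μ ξ (A ∪ B) ≤ ENNReal.ofReal (‖ξ‖ ^ 2) := (measure_mono (Set.subset_univ _)).trans (hμ ξ)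
  rw [measure_union hAB hB, he.2, hf.2, ← ENNReal.ofReal_add (by positivity) (by positivity)] at h
  exact (ENNReal.ofReal_le_ofReal_iff (by positivity)).1 h

lemma compl (he : IsProjectionOfSet μ Set.univ e) (hf : IsProjectionOfSet μ A f)
    (hA : MeasurableSet A) : IsProjectionOfSet μ Aᶜ (e - f) := by
  have hle : ∀ ξ, ‖f ξ‖ ≤ ‖e ξ‖ := by
    intro ξ
    have h : μ ξ A ≤ μ ξ Set.univ := measure_mono (Set.subset_univ _)
    rw [he.2, hf.2, ENNReal.ofReal_le_ofReal_iff (by positivity)] at h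
    exact (pow_le_pow_iff_left₀ (norm_nonneg _) (norm_nonneg _) two_ne_zero).1 h
  have hsub := hf.1.sub_of_mul_eq_left he.1 (he.1.mul_eq_left_of_norm_le hle)
  refine ⟨hsub, fun ξ => ?_⟩
  have hfin : μ ξ A ≠ ⊤ := by rw [hf.2]; exact ENNReal.ofReal_ne_top
  rw [measure_compl hA hfin, he.2, hf.2, ← ENNReal.ofReal_sub _ (by positivity),
    ← hsub.re_inner_apply_self, ← he.1.re_inner_apply_self, ← hf.1.re_inner_apply_self,
    _root_.sub_apply, inner_sub_right, Complex.sub_re]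

/-- Orthogonality is a hypothesis here, so no bound on the total mass is needed; this version
produces the projection of the whole space, from which that bound follows. -/
lemma iUnion_of_mul_eq_zero {ι : Type*} [Countable ι] {A : ι → Set X}
    (hA : ∀ i, MeasurableSet (A i)) (hdisj : Pairwise (Function.onFun Disjoint A))
    {e : ι → H →L[ℂ] H} (he : ∀ i, IsProjectionOfSet μ (A i) (e i))
    (horth : Pairwise fun i j => e i * e j = 0) :
    ∃ T, IsProjectionOfSet μ (⋃ i, A i) T ∧ ∀ ξ, HasSum (fun i => e i ξ) (T ξ) := by
  obtain ⟨T, hT, hsum⟩ := IsStarProjection.exists_hasSum (fun i => (he i).1) horth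
  refine ⟨T, ⟨hT, fun ξ => ?_⟩, hsum⟩
  have h1 : HasSum (fun i => (inner ℂ ξ (e i ξ)).re) (inner ℂ ξ (T ξ)).re :=
    Complex.hasSum_re ((hsum ξ).mapL (innerSL ℂ ξ))
  simp only [(he _).1.re_inner_apply_self, hT.re_inner_apply_self] at h1
  rw [measure_iUnion hdisj hA, ← h1.tsum_eq,
    ENNReal.ofReal_tsum_of_nonneg (fun _ => by positivity) h1.summable]
  exact tsum_congr fun i => (he i).2 ξ

lemma iUnion {ι : Type*} [Countable ι] (hμ : ∀ ξ, μ ξ Set.univ ≤ ENNReal.ofReal (‖ξ‖ ^ 2))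
    {A : ι → Set X} (hA : ∀ i, MeasurableSet (A i)) (hdisj : Pairwise (Function.onFun Disjoint A))
    {e : ι → H →L[ℂ] H} (he : ∀ i, IsProjectionOfSet μ (A i) (e i)) :
    ∃ T, IsProjectionOfSet μ (⋃ i, A i) T ∧ ∀ ξ, HasSum (fun i => e i ξ) (T ξ) :=
  iUnion_of_mul_eq_zero hA hdisj he
    fun _ j hij => (he _).mul_eq_zero hμ (he j) (hA j) (hdisj hij)

end IsProjectionOfSet

/-! ### Construction and continuity of projection valued measures. -/

namespace ProjectionValuedMeasure

variable {X : Type*} [MeasurableSpace X] {H : Type*} [NormedAddCommGroup H]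
  [InnerProductSpace ℂ H] [CompleteSpace H]

lemma ext_of_measurableSet {P Q : ProjectionValuedMeasure X H}
    (h : ∀ A, MeasurableSet A → P.toFun A = Q.toFun A) : P = Q := by
  have : P.toFun = Q.toFun := by
    funext A
    by_cases hA : MeasurableSet A
    · exact h A hA
    · rw [P.not_measurable A hA, Q.not_measurable A hA]
  cases P
  cases Q
  congr

/-- Measures `μ_ξ` whose values on a generating `π`-system are the quadratic forms of projections
come from a projection valued measure. -/
theorem exists_of_isProjectionOfSet {C : Set (Set X)}
    (hgen : ‹MeasurableSpace X› = MeasurableSpace.generateFrom C) (hC : IsPiSystem C)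
    {μ : H → Measure X} (huniv : ∃ e, IsProjectionOfSet μ Set.univ e)
    (h : ∀ A ∈ C, ∃ e, IsProjectionOfSet μ A e) :
    ∃ P : ProjectionValuedMeasure X H, ∀ A, MeasurableSet A →
      IsProjectionOfSet μ A (P.toFun A) := by
  classical
  obtain ⟨e, he⟩ := huniv
  have hμ : ∀ ξ, μ ξ Set.univ ≤ ENNReal.ofReal (‖ξ‖ ^ 2) := fun ξ => by
    rw [he.2]
    exact ENNReal.ofReal_le_ofReal (pow_le_pow_left₀ (norm_nonneg _) (he.1.norm_apply_le ξ) 2)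
  have hempty : IsProjectionOfSet μ ∅ (0 : H →L[ℂ] H) := ⟨by simp, by simp⟩
  have hall : ∀ A, MeasurableSet A → ∃ e, IsProjectionOfSet μ A e := by
    intro A hA
    induction A, hA using MeasurableSpace.induction_on_inter hgen hC with
    | empty => exact ⟨0, hempty⟩
    | basic A hA => exact h A hA
    | compl A hA ih =>
      obtain ⟨f, hf⟩ := ih
      exact ⟨e - f, he.compl hf hA⟩
    | iUnion A hdisj hA ih =>
      choose f hf using ih
      obtain ⟨T, hT, -⟩ := IsProjectionOfSet.iUnion hμ hA hdisj hf
      exact ⟨T, hT⟩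
  choose p hp using hall
  -- Multiplicativity follows from this splitting: in the product of the expansions of p(A) and
  -- p(B), only p(A ∩ B)² survives.
  have hdiff : ∀ A B (hA : MeasurableSet A) (hB : MeasurableSet B),
      p A hA = p (A ∩ B) (hA.inter hB) + p (A \ B) (hA.diff hB) := by
    intro A B hA hB
    have hd : Disjoint (A ∩ B) (A \ B) := disjoint_sdiff_self_right.mono_left Set.inter_subset_right
    refine (hp A hA).unique ⟨(hp _ _).1.add (hp _ _).1
      ((hp _ _).mul_eq_zero hμ (hp _ _) (hA.diff hB) hd), fun ξ => ?_⟩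
    have hs : IsStarProjection (p (A ∩ B) (hA.inter hB) + p (A \ B) (hA.diff hB)) :=
      (hp _ _).1.add (hp _ _).1 ((hp _ _).mul_eq_zero hμ (hp _ _) (hA.diff hB) hd)
    rw [← hs.re_inner_apply_self, _root_.add_apply, inner_add_right, Complex.add_re,
      (hp _ _).1.re_inner_apply_self, (hp _ _).1.re_inner_apply_self,
      ENNReal.ofReal_add (by positivity) (by positivity), ← (hp _ _).2, ← (hp _ _).2,
      measure_inter_add_sdiff A hB]
  let P : ProjectionValuedMeasure X H :=
    { toFun := fun A => if hA : MeasurableSet A then p A hA else 0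
      not_measurable := fun A hA => dif_neg hA
      isStarProjection := fun A hA => by
        rw [dif_pos hA]
        exact (hp A hA).1
      empty := by
        rw [dif_pos MeasurableSet.empty]
        exact (hp _ _).unique hempty
      inter := fun A B hA hB => by
        have hBA : p (B ∩ A) (hB.inter hA) = p (A ∩ B) (hA.inter hB) := by
          simp only [Set.inter_comm]
        rw [dif_pos hA, dif_pos hB, dif_pos (hA.inter hB), hdiff A B hA hB, hdiff B A hB hA, hBA,
          add_mul, mul_add, mul_add, (hp (A ∩ B) (hA.inter hB)).1.isIdempotentElem.eq,
          (hp (A ∩ B) (hA.inter hB)).mul_eq_zero hμ (hp (B \ A) _) (hB.diff hA)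
            (disjoint_sdiff_self_right.mono_left Set.inter_subset_left),
          (hp (A \ B) (hA.diff hB)).mul_eq_zero hμ (hp (A ∩ B) _) (hA.inter hB)
            (disjoint_sdiff_self_left.mono_right Set.inter_subset_right),
          (hp (A \ B) (hA.diff hB)).mul_eq_zero hμ (hp (B \ A) _) (hB.diff hA)
            (disjoint_sdiff_self_left.mono_right Set.sdiff_subset)]
        simp
      hasSum_iUnion := fun A hA hdisj ξ => by
        obtain ⟨T, hT, hsum⟩ := IsProjectionOfSet.iUnion hμ hA hdisj fun i => hp (A i) (hA i)
        rw [dif_pos (MeasurableSet.iUnion hA), (hp _ _).unique hT]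
        simpa only [dif_pos (hA _)] using hsum ξ }
  refine ⟨P, fun A hA => ?_⟩
  have : P.toFun A = p A hA := dif_pos hA
  rw [this]
  exact hp A hA

variable (P : ProjectionValuedMeasure X H)

/-- The measure `A ↦ ‖P(A)ξ‖²`. -/
noncomputable def quadraticMeasure (ξ : H) : Measure X :=
  Measure.ofMeasurable (fun A _ => ENNReal.ofReal (‖P.toFun A ξ‖ ^ 2)) (by simp [P.empty])
    (fun A hA hdisj => by
      have h1 : HasSum (fun i => (inner ℂ ξ (P.toFun (A i) ξ)).re)
          (inner ℂ ξ (P.toFun (⋃ i, A i) ξ)).re :=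
        Complex.hasSum_re ((P.hasSum_iUnion A hA hdisj ξ).mapL (innerSL ℂ ξ))
      simp only [(P.isStarProjection _ (hA _)).re_inner_apply_self,
        (P.isStarProjection _ (MeasurableSet.iUnion hA)).re_inner_apply_self] at h1
      rw [← h1.tsum_eq, ENNReal.ofReal_tsum_of_nonneg (fun _ => by positivity) h1.summable])

lemma quadraticMeasure_apply (ξ : H) {A : Set X} (hA : MeasurableSet A) :
    P.quadraticMeasure ξ A = ENNReal.ofReal (‖P.toFun A ξ‖ ^ 2) :=
  Measure.ofMeasurable_apply A hA

instance (ξ : H) : IsFiniteMeasure (P.quadraticMeasure ξ) :=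
  ⟨by rw [P.quadraticMeasure_apply ξ MeasurableSet.univ]; exact ENNReal.ofReal_lt_top⟩

lemma apply_apply {A B : Set X} (hA : MeasurableSet A) (hB : MeasurableSet B) (ξ : H) :
    P.toFun A (P.toFun B ξ) = P.toFun (A ∩ B) ξ := by
  rw [P.inter A B hA hB]
  rfl

/-- Finite additivity, recovered from countable additivity for the sequence A, B \ A, ∅, ∅, …. -/
lemma sub_apply_of_subset {A B : Set X} (hA : MeasurableSet A) (hB : MeasurableSet B)
    (h : A ⊆ B) (ξ : H) : P.toFun B ξ - P.toFun A ξ = P.toFun (B \ A) ξ := by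
  have hdisj : Pairwise fun i j : ℕ =>
      Disjoint ((fun n => if n = 0 then A else if n = 1 then B \ A else ∅) i)
        ((fun n => if n = 0 then A else if n = 1 then B \ A else ∅) j) := by
    intro i j hij
    have h1 : Disjoint A (B \ A) := disjoint_sdiff_self_right
    by_cases hi0 : i = 0 <;> by_cases hj0 : j = 0 <;> by_cases hi1 : i = 1 <;>
      by_cases hj1 : j = 1 <;> simp_all [h1.symm]
  have hs := P.hasSum_iUnion _ (fun i : ℕ => by
    show MeasurableSet (if i = 0 then A else if i = 1 then B \ A else ∅)
    split_ifs
    exacts [hA, hB.diff hA, MeasurableSet.empty]) hdisj ξ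
  have hU : (⋃ i : ℕ, if i = 0 then A else if i = 1 then B \ A else ∅) = B := by
    apply Set.Subset.antisymm
    · refine Set.iUnion_subset fun i => ?_
      split_ifs
      exacts [h, Set.sdiff_subset, Set.empty_subset _]
    · intro x hx
      by_cases hxA : x ∈ A
      · exact Set.mem_iUnion.2 ⟨0, by simpa using hxA⟩
      · exact Set.mem_iUnion.2 ⟨1, by simpa using ⟨hx, hxA⟩⟩
  rw [hU] at hs
  have hs2 := hasSum_sum_of_ne_finset_zero (f := fun i : ℕ =>
    P.toFun (if i = 0 then A else if i = 1 then B \ A else ∅) ξ) (s := {0, 1})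
    (L := SummationFilter.unconditional ℕ) (by
      intro b hb
      simp only [Finset.mem_insert, Finset.mem_singleton, not_or] at hb
      simp [hb.1, hb.2, P.empty])
  have h2 := hs.unique hs2
  rw [h2]
  simp

/-- Continuity from above in the strong operator topology. -/
lemma tendsto_iInter {A : ℕ → Set X} (hA : ∀ n, MeasurableSet (A n)) (hanti : Antitone A) (ξ : H) :
    Filter.Tendsto (fun n => P.toFun (A n) ξ) Filter.atTop (nhds (P.toFun (⋂ n, A n) ξ)) := by
  have hI : MeasurableSet (⋂ n, A n) := MeasurableSet.iInter hA
  rw [tendsto_iff_norm_sub_tendsto_zero]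
  -- The squared distance to the limit is the mass of `A n \ ⋂ n, A n` under a finite measure, and
  -- these sets decrease to ∅.
  have h1 := tendsto_measure_iInter_atTop (μ := P.quadraticMeasure ξ) (s := fun n => A n \ ⋂ n, A n)
    (fun n => ((hA n).diff hI).nullMeasurableSet)
    (fun m n hmn => Set.sdiff_subset_sdiff_left (hanti hmn)) ⟨0, measure_ne_top _ _⟩
  have h2 : (⋂ n, A n \ ⋂ n, A n) = ∅ := by
    ext x
    simp only [Set.mem_iInter, Set.mem_sdiff, Set.mem_empty_iff_false, iff_false]
    intro h
    exact (h 0).2 fun n => (h n).1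
  rw [h2, measure_empty] at h1
  have h3 := (ENNReal.tendsto_toReal ENNReal.zero_ne_top).comp h1
  have h4 := h3.sqrt
  simp only [Function.comp_def, P.quadraticMeasure_apply ξ ((hA _).diff hI),
    ENNReal.toReal_ofReal (sq_nonneg _), Real.sqrt_sq (norm_nonneg _), ENNReal.toReal_zero,
    Real.sqrt_zero] at h4
  simpa only [P.sub_apply_of_subset hI (hA _) (Set.iInter_subset _ _)] using h4

end ProjectionValuedMeasure

/-! ### Factorizations, segments and limits of paths. -/

section Arrow

variable {C : Type*} [Category C]

lemma arrowMk_comp_congr {a b c a' b' c' : C} {g : a ⟶ b} {f : b ⟶ c} {g' : a' ⟶ b'} {f' : b' ⟶ c'}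
    (hg : Arrow.mk g = Arrow.mk g') (hf : Arrow.mk f = Arrow.mk f') :
    Arrow.mk (g ≫ f) = Arrow.mk (g' ≫ f') := by
  cases hg
  cases hf
  rfl

lemma exists_arrowMk_eq {x y : C} (a : Arrow C) (hx : a.left = x) (hy : a.right = y) :
    ∃ m : x ⟶ y, Arrow.mk m = a := by
  subst hx hy
  exact ⟨a.hom, rfl⟩

end Arrow

namespace KGraph

open Filter

section Factorization

variable {k : ℕ} {V : Type u} [SmallCategory V] [KGraph k V]

lemma degree_congr {a b a' b' : V} {f : a ⟶ b} {f' : a' ⟶ b'} (h : Arrow.mk f = Arrow.mk f') :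
    degree (k := k) f = degree f' := by
  cases h
  rfl

/-- Unique factorization: two factorizations of a path whose left factors have the same degree
coincide. -/
lemma factorization_unique {u w c₁ c₂ : V} {f₁ : c₁ ⟶ w} {g₁ : u ⟶ c₁} {f₂ : c₂ ⟶ w} {g₂ : u ⟶ c₂}
    (h : g₁ ≫ f₁ = g₂ ≫ f₂) (hdeg : degree (k := k) f₁ = degree f₂) :
    (⟨c₁, f₁, g₁⟩ : Σ c : V, (c ⟶ w) × (u ⟶ c)) = ⟨c₂, f₂, g₂⟩ := by
  have hd : degree (k := k) g₁ = degree g₂ := by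
    have := degree_comp (k := k) g₁ f₁
    rw [h, degree_comp, hdeg] at this
    exact (add_left_cancel this).symm
  exact (factorization (g₁ ≫ f₁) _ _ (degree_comp (k := k) g₁ f₁)).unique ⟨rfl, rfl, rfl⟩
    ⟨hdeg.symm, hd.symm, h.symm⟩

lemma comp_right_cancel (k : ℕ) {V : Type u} [SmallCategory V] [KGraph k V] {u v w : V} {g₁ g₂ : u ⟶ v} {f : v ⟶ w} (h : g₁ ≫ f = g₂ ≫ f) :
    g₁ = g₂ := by
  have := factorization_unique (k := k) h rfl
  simpa using this

/-- Equality in `Arrow` allows the endpoints to be compared along with the paths, without transport.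
-/
lemma arrowMk_factors_unique {u w u' w' c₁ c₂ : V} {f₁ : c₁ ⟶ w} {g₁ : u ⟶ c₁} {f₂ : c₂ ⟶ w'}
    {g₂ : u' ⟶ c₂} (h : Arrow.mk (g₁ ≫ f₁) = Arrow.mk (g₂ ≫ f₂))
    (hdeg : degree (k := k) f₁ = degree f₂) :
    Arrow.mk f₁ = Arrow.mk f₂ ∧ Arrow.mk g₁ = Arrow.mk g₂ := by
  obtain ⟨rfl, rfl, h'⟩ := (Arrow.mk_eq_mk_iff _ _).1 h
  simp only [eqToHom_refl, Category.comp_id, Category.id_comp] at h'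
  cases factorization_unique h' hdeg
  exact ⟨rfl, rfl⟩

lemma arrowMk_eq_id {v w : V} {f : v ⟶ w} (h : degree (k := k) f = 0) :
    Arrow.mk f = Arrow.mk (𝟙 w) :=
  (arrowMk_factors_unique (k := k) (g₁ := 𝟙 v) (f₁ := f) (g₂ := f) (f₂ := 𝟙 w) (by simp)
    (by rw [h, degree_id])).1

lemma arrowMk_comp_of_degree_eq_zero {u v w : V} (g : u ⟶ v) {f : v ⟶ w}
    (h : degree (k := k) f = 0) : Arrow.mk (g ≫ f) = Arrow.mk g := by
  have h1 := arrowMk_eq_id h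
  obtain rfl : v = w := congrArg Arrow.left h1
  rw [(Arrow.mk_inj _ _).1 h1, Category.comp_id]

/-- The segments `f(p ∧ d(f), q ∧ d(f))` of a path `f`. -/
lemma exists_segments {v w : V} (f : v ⟶ w) :
    ∃ (obj : (Fin k → ℕ) → V) (map : ∀ p q : Fin k → ℕ, p ≤ q → (obj q ⟶ obj p)),
      (∀ p, map p p le_rfl = 𝟙 _) ∧
      (∀ p q r (h : p ≤ q) (h' : q ≤ r), map q r h' ≫ map p q h = map p r (h.trans h')) ∧
      (∀ p q (h : p ≤ q), degree (map p q h) = q ⊓ degree f - p ⊓ degree f) ∧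
      ∀ {c : V} (g : c ⟶ w) (e : v ⟶ c) (h : 0 ≤ degree (k := k) g), e ≫ g = f →
        Arrow.mk (map 0 (degree g) h) = Arrow.mk g := by
  -- Degrees are cut off at d(f), so that the segments are defined for all p ≤ q and become
  -- identities beyond d(f).
  have hfac : ∀ p : Fin k → ℕ, ∃ (c : V) (g : c ⟶ w) (e : v ⟶ c),
      degree g = p ⊓ degree f ∧ e ≫ g = f := by
    intro p
    obtain ⟨⟨c, g, e⟩, ⟨h1, -, h3⟩, -⟩ :=
      factorization f (p ⊓ degree f) (degree f - p ⊓ degree f)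
        (add_tsub_cancel_of_le inf_le_right).symm
    exact ⟨c, g, e, h1, h3⟩
  choose obj pre rest hpre hrest using hfac
  have hmap : ∀ p q : Fin k → ℕ, p ≤ q → ∃ m : obj q ⟶ obj p,
      m ≫ pre p = pre q ∧ degree m = q ⊓ degree f - p ⊓ degree f := by
    intro p q h
    have hle : p ⊓ degree f ≤ q ⊓ degree f := inf_le_inf_right _ h
    obtain ⟨⟨c, g, e⟩, ⟨h1, h2, h3⟩, -⟩ :=
      factorization (pre q) (p ⊓ degree f) (q ⊓ degree f - p ⊓ degree f)
        ((hpre q).trans (add_tsub_cancel_of_le hle).symm)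
    dsimp only at h1 h2 h3
    -- Both g and `pre p` are initial pieces of f of the same degree, so they agree.
    have h4 := factorization_unique (k := k) (f₁ := g) (g₁ := rest q ≫ e) (f₂ := pre p)
      (g₂ := rest p) (by rw [Category.assoc, h3, hrest, hrest]) (h1.trans (hpre p).symm)
    generalize rest q ≫ e = r at h4
    cases h4
    exact ⟨e, h3, h2⟩
  choose map hmap1 hmap2 using hmap
  refine ⟨obj, map, ?_, ?_, hmap2, ?_⟩
  · intro p
    exact comp_right_cancel k (by rw [hmap1, Category.id_comp])
  · intro p q r h h'
    exact comp_right_cancel k (by rw [Category.assoc, hmap1, hmap1, hmap1])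
  · intro c g e h he
    have hle : degree (k := k) g ≤ degree f := by
      rw [← he, degree_comp]
      exact le_self_add
    have h0 : degree (k := k) (pre 0) = 0 := by
      rw [hpre]
      exact inf_eq_left.2 fun _ => Nat.zero_le _
    rw [← arrowMk_comp_of_degree_eq_zero (map 0 (degree g) h) h0, hmap1]
    exact (arrowMk_factors_unique (k := k) (g₁ := rest (degree g)) (g₂ := e)
      (by rw [hrest, he]) ((hpre _).trans (inf_eq_left.2 hle))).1

/-- Functors `Ω_k → Λ` that preserve more and more degrees have a limit along any ultrafilter. -/
lemma exists_infinitePath_of_ultrafilter (hfin : IsFinite k V) {I : Type*} (U : Ultrafilter I)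
    (obj : I → (Fin k → ℕ) → V)
    (map : ∀ (i : I) (p q : Fin k → ℕ), p ≤ q → (obj i q ⟶ obj i p))
    (hid : ∀ i p, map i p p le_rfl = 𝟙 _)
    (hcomp : ∀ i p q r (h : p ≤ q) (h' : q ≤ r), map i q r h' ≫ map i p q h = map i p r (h.trans h'))
    (hdeg : ∀ p q (h : p ≤ q), ∀ᶠ i in (U : Filter I), degree (map i p q h) = q - p) :
    ∃ x : InfinitePath k V, ∀ p q (h : p ≤ q), ∀ᶠ i in (U : Filter I),
      Arrow.mk (map i p q h) = Arrow.mk (x.map h) := by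
  have hlim : ∀ p q (h : p ≤ q), ∃ a : Arrow V, ∀ᶠ i in (U : Filter I),
      Arrow.mk (map i p q h) = a := by
    intro p q h
    -- Eventually the segment ranges over the finite set of paths of degree q - p, so the
    -- ultrafilter selects one of them.
    have h1 : ∀ᶠ i in (U : Filter I), ∃ a ∈ {a : Arrow V | degree (k := k) a.hom = q - p},
        Arrow.mk (map i p q h) = a := by
      filter_upwards [hdeg p q h] with i hi
      exact ⟨_, hi, rfl⟩
    obtain ⟨a, -, ha⟩ := (Ultrafilter.eventually_exists_mem_iff (hfin _)).1 h1
    exact ⟨a, ha⟩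
  choose a ha using hlim
  have hobj : ∀ p, ∀ᶠ i in (U : Filter I), obj i p = (a p p le_rfl).left := by
    intro p
    filter_upwards [ha p p le_rfl] with i hi
    exact congrArg Arrow.left hi
  have hm : ∀ p q (h : p ≤ q), ∃ m : (a q q le_rfl).left ⟶ (a p p le_rfl).left,
      Arrow.mk m = a p q h := by
    intro p q h
    -- Each property of the limit involves finitely many segments, hence can be read off at one
    -- index where all of them have their limiting values.
    obtain ⟨i, hi, hp, hq⟩ := ((ha p q h).and ((hobj p).and (hobj q))).exists
    refine exists_arrowMk_eq _ ?_ ?_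
    · rw [← hi, ← hq]; rfl
    · rw [← hi, ← hp]; rfl
  choose m hm using hm
  refine ⟨⟨fun p => (a p p le_rfl).left, fun {p q} h => m p q h, ?_, ?_, ?_⟩, fun p q h => ?_⟩
  · intro p
    obtain ⟨i, hi, hp⟩ := ((ha p p le_rfl).and (hobj p)).exists
    apply Arrow.mk_injective
    rw [hm, ← hi, hid, hp]
    rfl
  · intro p q r h h'
    obtain ⟨i, h1, h2, h3⟩ := ((ha p q h).and ((ha q r h').and (ha p r (h.trans h')))).exists
    apply Arrow.mk_injective
    rw [hm, ← h3, ← hcomp i p q r h h']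
    exact arrowMk_comp_congr ((hm _ _ _).trans h2.symm) ((hm _ _ _).trans h1.symm)
  · intro p q h
    obtain ⟨i, h1, h2⟩ := ((ha p q h).and (hdeg p q h)).exists
    rw [← h2]
    exact degree_congr ((hm _ _ _).trans h1.symm)
  · filter_upwards [ha p q h] with i hi
    rw [hi]
    exact (hm p q h).symm

end Factorization

/-! ### Infinite paths and cylinder sets. -/

namespace InfinitePath

variable {k : ℕ} {V : Type u} [SmallCategory V] [KGraph k V]

lemma degree_initial (x : InfinitePath k V) (m : Fin k → ℕ) :
    degree (k := k) (x.initial m).hom = m :=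
  (x.degree_map _).trans (tsub_zero m)

lemma initial_eq_comp (x : InfinitePath k V) {m n : Fin k → ℕ} (h : m ≤ n) :
    x.initial n = Arrow.mk (x.map h ≫ x.map (show 0 ≤ m from fun _ => Nat.zero_le _)) :=
  congrArg Arrow.mk (x.map_comp _ _).symm

lemma arrowMk_map_eq {x y : InfinitePath k V} {m n : Fin k → ℕ} (h : m ≤ n)
    (hxy : x.initial n = y.initial n) :
    x.initial m = y.initial m ∧ Arrow.mk (x.map h) = Arrow.mk (y.map h) := by
  rw [x.initial_eq_comp h, y.initial_eq_comp h] at hxy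
  exact arrowMk_factors_unique (k := k) hxy (by rw [x.degree_map, y.degree_map])

/-- The degrees (n, …, n) are cofinal in ℕᵏ, and a long initial segment determines every segment
inside it. -/
lemma ext_of_initial {x y : InfinitePath k V} (h : ∀ n : ℕ, x.initial (fun _ => n) =
    y.initial (fun _ => n)) : x = y := by
  have hmap : ∀ (p q : Fin k → ℕ) (hpq : p ≤ q), Arrow.mk (x.map hpq) = Arrow.mk (y.map hpq) := by
    intro p q hpq
    have hq : q ≤ fun _ => Finset.univ.sup q := fun i => Finset.le_sup (Finset.mem_univ i)
    exact (arrowMk_map_eq hpq (arrowMk_map_eq hq (h _)).1).2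
  have hobj : x.obj = y.obj := by
    funext p
    exact congrArg Arrow.left (hmap p p le_rfl)
  obtain ⟨xo, xm, x1, x2, x3⟩ := x
  obtain ⟨yo, ym, y1, y2, y3⟩ := y
  dsimp only at hobj hmap
  subst hobj
  have : @xm = @ym := by
    funext p q hpq
    exact Arrow.mk_injective _ _ (hmap p q hpq)
  subst this
  rfl

end InfinitePath

section Cylinder

variable {k : ℕ} {V : Type u} [SmallCategory V] [KGraph k V]

lemma exists_le_const (m : Fin k → ℕ) : ∃ n : ℕ, m ≤ fun _ => n :=
  ⟨Finset.univ.sup m, fun i => Finset.le_sup (Finset.mem_univ i)⟩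

lemma mem_cylinder_iff {x : InfinitePath k V} {v w : V} {f : v ⟶ w} :
    x ∈ cylinder f ↔ x.initial (degree f) = Arrow.mk f :=
  Iff.rfl

lemma mem_cylinder_initial_iff {x y : InfinitePath k V} {m : Fin k → ℕ} :
    x ∈ cylinder (y.initial m).hom ↔ x.initial m = y.initial m := by
  rw [mem_cylinder_iff, y.degree_initial]
  rfl

lemma cylinder_subset_cylinder {x : InfinitePath k V} {v w v' w' : V} {f : v ⟶ w} {g : v' ⟶ w'}
    (hf : x ∈ cylinder f) (hg : x ∈ cylinder g) (h : degree (k := k) f ≤ degree g) :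
    (cylinder g : Set (InfinitePath k V)) ⊆ cylinder f := by
  intro y hy
  rw [mem_cylinder_iff] at *
  rw [(InfinitePath.arrowMk_map_eq h (hy.trans hg.symm)).1, hf]

lemma cylinder_disjoint {v w v' w' : V} {f : v ⟶ w} {g : v' ⟶ w'}
    (h : degree (k := k) f = degree g) (hne : Arrow.mk f ≠ Arrow.mk g) :
    Disjoint (cylinder f : Set (InfinitePath k V)) (cylinder g) := by
  rw [Set.disjoint_left]
  intro x hf hg
  rw [mem_cylinder_iff] at hf hg
  rw [h] at hf
  exact hne (hf.symm.trans hg)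

lemma iUnion_cylinder_id : ⋃ v : V, (cylinder (𝟙 v) : Set (InfinitePath k V)) = Set.univ := by
  refine Set.eq_univ_of_forall fun x => Set.mem_iUnion.2 ⟨x.obj 0, ?_⟩
  rw [mem_cylinder_iff, degree_id]
  exact congrArg Arrow.mk (x.map_id 0)

lemma iInter_cylinder_initial (x : InfinitePath k V) :
    ⋂ n : ℕ, (cylinder (x.initial fun _ => n).hom : Set (InfinitePath k V)) = {x} := by
  ext y
  simp only [Set.mem_iInter, mem_cylinder_initial_iff, Set.mem_singleton_iff]
  exact ⟨InfinitePath.ext_of_initial, fun h n => by rw [h]⟩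

lemma antitone_cylinder_initial (x : InfinitePath k V) :
    Antitone fun n : ℕ => (cylinder (x.initial fun _ => n).hom : Set (InfinitePath k V)) := by
  intro m n hmn y hy
  rw [mem_cylinder_initial_iff] at hy ⊢
  exact (InfinitePath.arrowMk_map_eq (fun _ => hmn) hy).1

lemma isOpen_cylinder {v w : V} (f : v ⟶ w) : IsOpen (cylinder f : Set (InfinitePath k V)) :=
  TopologicalSpace.isOpen_generateFrom_of_mem ⟨v, w, f, rfl⟩

lemma measurableSet_cylinder {v w : V} (f : v ⟶ w) :
    MeasurableSet (cylinder f : Set (InfinitePath k V)) :=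
  (isOpen_cylinder f).measurableSet

lemma measurableSet_singleton_infinitePath (x : InfinitePath k V) : MeasurableSet {x} := by
  rw [← iInter_cylinder_initial]
  exact MeasurableSet.iInter fun _ => measurableSet_cylinder _

instance : MeasurableSingletonClass (InfinitePath k V) :=
  ⟨measurableSet_singleton_infinitePath⟩

lemma setOf_cylinder_eq_range :
    {Z : Set (InfinitePath k V) | ∃ (v w : V) (f : v ⟶ w), Z = cylinder f} =
      Set.range fun a : Arrow V => (cylinder a.hom : Set (InfinitePath k V)) := by
  ext Z
  constructor
  · rintro ⟨v, w, f, rfl⟩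
    exact ⟨Arrow.mk f, rfl⟩
  · rintro ⟨a, rfl⟩
    exact ⟨_, _, a.hom, rfl⟩

instance : SecondCountableTopology (InfinitePath k V) := by
  have := countable_paths (k := k) (V := V)
  refine ⟨⟨_, ?_, rfl⟩⟩
  rw [setOf_cylinder_eq_range]
  exact Set.countable_range _

variable (k V) in
/-- The cylinder sets of the paths whose degree is a multiple of `(1, …, 1)`. -/
def diagonalCylinders : Set (Set (InfinitePath k V)) :=
  {Z | ∃ (v w : V) (f : v ⟶ w) (n : ℕ), degree (k := k) f = (fun _ => n) ∧ Z = cylinder f}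

/-- Diagonal degrees are totally ordered, so two such cylinders that meet are nested. For
incomparable degrees the intersection need not be a cylinder. -/
lemma isPiSystem_diagonalCylinders : IsPiSystem (diagonalCylinders k V) := by
  rintro _ ⟨v, w, f, m, hm, rfl⟩ _ ⟨v', w', g, n, hn, rfl⟩ ⟨x, hf, hg⟩
  rcases le_total m n with h | h
  · have h1 : degree (k := k) f ≤ degree g := by
      rw [hm, hn]
      exact fun _ => h
    rw [Set.inter_eq_right.2 (cylinder_subset_cylinder hf hg h1)]
    exact ⟨_, _, g, n, hn, rfl⟩
  · have h1 : degree (k := k) g ≤ degree f := by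
      rw [hm, hn]
      exact fun _ => h
    rw [Set.inter_eq_left.2 (cylinder_subset_cylinder hg hf h1)]
    exact ⟨_, _, f, m, hm, rfl⟩

lemma borel_eq_generateFrom_diagonalCylinders :
    (inferInstance : MeasurableSpace (InfinitePath k V)) =
      MeasurableSpace.generateFrom (diagonalCylinders k V) := by
  have := countable_paths (k := k) (V := V)
  refine (borel_eq_generateFrom_of_subbasis rfl).trans (le_antisymm ?_ ?_)
  · refine MeasurableSpace.generateFrom_le ?_
    rintro _ ⟨v, w, f, rfl⟩
    obtain ⟨n, hn⟩ := exists_le_const (degree (k := k) f)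
    have h : (cylinder f : Set (InfinitePath k V)) =
        ⋃ a ∈ {a : Arrow V | degree (k := k) a.hom = (fun _ => n) ∧
          (cylinder a.hom : Set (InfinitePath k V)) ⊆ cylinder f}, cylinder a.hom := by
      apply Set.Subset.antisymm
      · intro x hx
        have hx' : x ∈ cylinder (x.initial fun _ => n).hom := mem_cylinder_initial_iff.2 rfl
        refine Set.mem_biUnion ⟨x.degree_initial _, cylinder_subset_cylinder hx hx' ?_⟩ hx'
        rwa [x.degree_initial]
      · exact Set.iUnion₂_subset fun a ha => ha.2
    rw [h]
    exact MeasurableSet.biUnion (Set.to_countable _) fun a ha =>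
      MeasurableSpace.measurableSet_generateFrom ⟨_, _, a.hom, n, ha.1, rfl⟩
  · refine MeasurableSpace.generateFrom_mono ?_
    rintro _ ⟨v, w, f, n, -, rfl⟩
    exact ⟨v, w, f, rfl⟩

/-- Borel measures that are finite on cylinder sets are determined by their values there. -/
lemma measure_ext_of_cylinder {μ ν : Measure (InfinitePath k V)}
    (h : ∀ {v w : V} (f : v ⟶ w), μ (cylinder f) = ν (cylinder f))
    (hμ : ∀ v : V, μ (cylinder (𝟙 v)) ≠ ⊤) : μ = ν := by
  have := countable_paths (k := k) (V := V)
  have : Countable V :=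
    Function.Injective.countable (f := fun v : V => Arrow.mk (𝟙 v)) fun _ _ h =>
      congrArg Arrow.left h
  refine Measure.ext_of_generateFrom_of_cover_subset
    (T := Set.range fun v : V => (cylinder (𝟙 v) : Set (InfinitePath k V)))
    borel_eq_generateFrom_diagonalCylinders isPiSystem_diagonalCylinders ?_
    (Set.countable_range _) ?_ ?_ ?_
  · rintro _ ⟨v, rfl⟩
    exact ⟨v, v, 𝟙 v, 0, degree_id v, rfl⟩
  · rw [Set.sUnion_range, iUnion_cylinder_id]
  · rintro _ ⟨v, rfl⟩
    exact hμ v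
  · rintro _ ⟨v, w, f, n, -, rfl⟩
    exact h f

/-- The infinite path space of a finite `k`-graph is compact. -/
lemma compactSpace_infinitePath (hfin : IsFinite k V) : CompactSpace (InfinitePath k V) := by
  rw [← isCompact_univ_iff, isCompact_iff_ultrafilter_le_nhds]
  intro U _
  obtain ⟨x, hx⟩ := exists_infinitePath_of_ultrafilter hfin U (fun y p => y.obj p)
    (fun y p q h => y.map h) (fun y p => y.map_id p) (fun y p q r h h' => y.map_comp h h')
    (fun p q h => Eventually.of_forall fun y => y.degree_map h)
  refine ⟨x, Set.mem_univ _, ?_⟩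
  rw [TopologicalSpace.nhds_generateFrom]
  refine le_iInf₂ fun s hs => ?_
  obtain ⟨hxs, v, w, f, rfl⟩ := hs
  rw [le_principal_iff]
  filter_upwards [hx 0 (degree f) fun _ => Nat.zero_le _] with y hy
  rw [mem_cylinder_iff] at hxs ⊢
  exact hy.trans hxs

/-- Without sources f extends by a path of each degree n; an ultrafilter limit of these ever longer
finite paths is an infinite path beginning with f. -/
lemma cylinder_nonempty (hfin : IsFinite k V) (hsrc : NoSources k V) {v w : V} (f : v ⟶ w) :
    (cylinder f : Set (InfinitePath k V)).Nonempty := by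
  choose c g hg using fun n : Fin k → ℕ => hsrc v n
  choose obj map hid hcomp hdeg hinit using
    fun n : Fin k → ℕ => exists_segments (k := k) (g n ≫ f)
  obtain ⟨x, hx⟩ := exists_infinitePath_of_ultrafilter hfin
    (Ultrafilter.of (atTop : Filter (Fin k → ℕ))) obj map hid hcomp (by
      intro p q h
      refine Ultrafilter.of_le _ ?_
      filter_upwards [eventually_ge_atTop q] with n hn
      have hq : q ≤ degree (k := k) (g n ≫ f) := by
        rw [degree_comp, hg]
        exact hn.trans le_add_self
      rw [hdeg, inf_eq_left.2 hq, inf_eq_left.2 (h.trans hq)])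
  refine ⟨x, ?_⟩
  obtain ⟨n, hn⟩ := (hx 0 (degree f) fun _ => Nat.zero_le _).exists
  rw [mem_cylinder_iff]
  exact hn.symm.trans (hinit n f (g n) _ rfl)

end Cylinder

end KGraph

/-! ### Measures on the path space from consistent weights. -/

open Filter in
/-- On a compact space whose `σ`-algebra is generated by the clopen sets, any family of measures
has a limit along an ultrafilter, setwise on the clopen sets. -/
lemma exists_measure_tendsto_of_ultrafilter {X : Type*} [TopologicalSpace X] [CompactSpace X]
    [MeasurableSpace X]
    (hgen : ‹MeasurableSpace X› = MeasurableSpace.generateFrom {A : Set X | IsClopen A})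
    {I : Type*} (U : Ultrafilter I) (ν : I → Measure X) :
    ∃ μ : Measure X, ∀ A, IsClopen A → Tendsto (fun i => ν i A) U (nhds (μ A)) := by
  have hmeas : ∀ A : Set X, IsClopen A → MeasurableSet A := fun A hA => by
    rw [hgen]
    exact MeasurableSpace.measurableSet_generateFrom hA
  have hlim : ∀ A : Set X, ∃ l, Tendsto (fun i => ν i A) U (nhds l) := fun A =>
    ⟨_, (U.map fun i => ν i A).le_nhds_lim⟩
  choose m hm using hlim
  have hC : IsSetRing {A : Set X | IsClopen A} :=
    { empty_mem := isClopen_empty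
      union_mem := fun _ _ hs ht => IsClopen.union hs ht
      sdiff_mem := fun _ _ hs ht => IsClopen.diff hs ht }
  let M : AddContent ENNReal {A : Set X | IsClopen A} :=
    { toFun := m
      empty' := tendsto_nhds_unique (hm ∅) (by simp)
      sUnion' := fun J hJ hdisj _ => by
        refine tendsto_nhds_unique (hm _) ?_
        have h : ∀ i, ν i (⋃₀ ↑J) = ∑ s ∈ J, ν i s := fun i => by
          rw [Set.sUnion_eq_biUnion]
          exact measure_biUnion_finset hdisj fun s hs => hmeas s (hJ hs)
        simp only [h]
        exact tendsto_finsetSum _ fun s _ => hm s }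
  -- If a countable union of clopen sets is clopen, it is compact, so finitely many of them cover it
  -- and finite subadditivity passes to the limit.
  have hsub : M.IsSigmaSubadditive := by
    intro f hf hU
    obtain ⟨F, hF⟩ := hU.isClosed.isCompact.elim_finite_subcover f (fun i => (hf i).isOpen)
      subset_rfl
    refine le_trans ?_ (ENNReal.sum_le_tsum F)
    exact le_of_tendsto_of_tendsto' (hm _) (tendsto_finsetSum F fun i _ => hm (f i)) fun i =>
      (measure_mono hF).trans (measure_biUnion_finset_le F f)
  refine ⟨M.measure hC.isSetSemiring hgen.le hsub, fun A hA => ?_⟩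
  rw [AddContent.measure_eq M hC.isSetSemiring hgen hsub hA]
  exact hm A

namespace KGraph

variable {k : ℕ} {V : Type u} [SmallCategory V] [KGraph k V]

lemma isClopen_cylinder {v w : V} (f : v ⟶ w) : IsClopen (cylinder f : Set (InfinitePath k V)) := by
  refine ⟨⟨?_⟩, isOpen_cylinder f⟩
  rw [isOpen_iff_mem_nhds]
  intro x hx
  refine Filter.mem_of_superset
    ((isOpen_cylinder (x.initial (degree f)).hom).mem_nhds (mem_cylinder_initial_iff.2 rfl)) ?_
  intro y hy hyf
  exact hx ((mem_cylinder_initial_iff.1 hy).symm.trans hyf)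

lemma borel_eq_generateFrom_isClopen :
    (inferInstance : MeasurableSpace (InfinitePath k V)) =
      MeasurableSpace.generateFrom {A : Set (InfinitePath k V) | IsClopen A} := by
  refine le_antisymm ?_ (MeasurableSpace.generateFrom_le fun A hA => IsOpen.measurableSet hA.2)
  refine borel_eq_generateFrom_diagonalCylinders.le.trans (MeasurableSpace.generateFrom_mono ?_)
  rintro _ ⟨v, w, f, n, -, rfl⟩
  exact isClopen_cylinder f

/-- The extensions of degree `n` of a path `f` are the paths `fg` with `d(g) = n - d(f)`. -/
lemma tsum_extensions {x : Arrow V → InfinitePath k V}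
    (hx : ∀ a : Arrow V, x a ∈ cylinder a.hom) (c : Arrow V → ENNReal) {v w : V} (f : v ⟶ w)
    {n : Fin k → ℕ} (hn : degree f ≤ n) :
    ∑' b : {b : Arrow V // degree (k := k) b.hom = n},
        c b * (cylinder f).indicator 1 (x b) =
      ∑' g : PathsTo v (n - degree (k := k) f), c (Arrow.mk (g.1.2 ≫ f)) := by
  let F : PathsTo v (n - degree (k := k) f) → {b : Arrow V // degree (k := k) b.hom = n} :=
    fun g => ⟨Arrow.mk (g.1.2 ≫ f), (degree_comp g.1.2 f).trans (by
      rw [g.2]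
      exact add_tsub_cancel_of_le hn)⟩
  have hF : Function.Injective F := by
    rintro ⟨⟨u, g⟩, hg⟩ ⟨⟨u', g'⟩, hg'⟩ h
    have h1 := (arrowMk_factors_unique (k := k) (congrArg Subtype.val h) rfl).2
    cases h1
    rfl
  have hval : ∀ g, x (F g) ∈ (cylinder f : Set (InfinitePath k V)) := by
    intro g
    have h1 := hx (F g).1
    rw [mem_cylinder_iff] at h1 ⊢
    have h2 : degree (k := k) f ≤ degree (F g).1.hom := hn.trans (F g).2.ge
    rw [InfinitePath.initial_eq_comp _ h2] at h1
    refine (arrowMk_factors_unique (k := k) (g₂ := g.1.2) h1 ?_).1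
    exact ((x (F g)).degree_map _).trans (tsub_zero _)
  rw [← hF.tsum_eq]
  · refine tsum_congr fun g => ?_
    rw [Set.indicator_of_mem (hval g), Pi.one_apply, mul_one]
  -- A nonzero term has `x b` in Z(f); the segment of `x b` from d(f) to n then exhibits b as an
  -- extension of f.
  · rintro ⟨b, hb⟩ hne
    have hxb : x b ∈ (cylinder f : Set (InfinitePath k V)) := by
      by_contra h
      exact hne (by simp [Set.indicator_of_notMem h])
    have h1 := hx b
    rw [mem_cylinder_iff] at h1 hxb
    rw [InfinitePath.initial_eq_comp _ (hn.trans hb.ge)] at h1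
    obtain ⟨e, he⟩ := exists_arrowMk_eq (Arrow.mk ((x b).map (hn.trans hb.ge))) rfl
      (congrArg Arrow.left hxb)
    refine ⟨⟨⟨_, e⟩, ?_⟩, Subtype.ext ((arrowMk_comp_congr he hxb.symm).trans h1)⟩
    rw [degree_congr he, InfinitePath.degree_map, hb]

/-- A consistent system of weights on the paths of a finite `k`-graph without sources extends to a
Borel measure on the infinite path space. -/
lemma exists_measure_of_weights (hfin : IsFinite k V) (hsrc : NoSources k V)
    (c : Arrow V → ENNReal)
    (hc : ∀ {v w : V} (f : v ⟶ w) (n : Fin k → ℕ),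
      ∑' g : PathsTo v n, c (Arrow.mk (g.1.2 ≫ f)) = c (Arrow.mk f)) :
    ∃ μ : Measure (InfinitePath k V), ∀ {v w : V} (f : v ⟶ w),
      μ (cylinder f) = c (Arrow.mk f) := by
  have := compactSpace_infinitePath hfin
  choose x hx using fun a : Arrow V => cylinder_nonempty hfin hsrc a.hom
  -- Place the mass `c b` at one chosen point of Z(b), for each b of degree n. Consistency makes the
  -- mass of Z(f) equal to c(f) as soon as n ≥ d(f).
  let ν : (Fin k → ℕ) → Measure (InfinitePath k V) := fun n =>
    Measure.sum fun b : {b : Arrow V // degree (k := k) b.hom = n} => c b • Measure.dirac (x b)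
  obtain ⟨μ, hμ⟩ := exists_measure_tendsto_of_ultrafilter borel_eq_generateFrom_isClopen
    (Ultrafilter.of Filter.atTop) ν
  refine ⟨μ, fun f => tendsto_nhds_unique (hμ _ (isClopen_cylinder f)) ?_⟩
  refine tendsto_const_nhds.congr' (Ultrafilter.of_le _ ?_)
  filter_upwards [Filter.eventually_ge_atTop (degree f)] with n hn
  rw [Measure.sum_apply _ (measurableSet_cylinder f), ← hc f (n - degree f),
    ← tsum_extensions hx c f hn]
  refine tsum_congr fun b => ?_
  rw [Measure.smul_apply, smul_eq_mul, Measure.dirac_apply' _ (measurableSet_cylinder f)]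

end KGraph

/-! ### The projection valued measure of a representation. -/

namespace KGraph

section Representation

variable {k : ℕ} {V : Type u} [SmallCategory V] [KGraph k V]
variable {H : Type*} [NormedAddCommGroup H] [InnerProductSpace ℂ H] [CompleteSpace H]

lemma finite_pathsTo (hfin : IsFinite k V) (v : V) (n : Fin k → ℕ) : Finite (PathsTo v n) := by
  have := (hfin n).to_subtype
  refine Finite.of_injective (β := {a : Arrow V | degree (k := k) a.hom = n})
    (fun g => ⟨Arrow.mk g.1.2, g.2⟩) ?_
  rintro ⟨⟨u, g⟩, hg⟩ ⟨⟨u', g'⟩, hg'⟩ h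
  cases congrArg Subtype.val h
  rfl

lemma IsMeasureOf.unique {t : ∀ {v w : V}, (v ⟶ w) → (H →L[ℂ] H)} {ξ : H} {μ ν : Measure (InfinitePath k V)}
    (hμ : IsMeasureOf t ξ μ) (hν : IsMeasureOf t ξ ν) : μ = ν :=
  measure_ext_of_cylinder (fun f => (hμ f).trans (hν f).symm) fun v => by
    rw [hμ]
    exact ENNReal.ofReal_ne_top

namespace IsRepresentation

variable {t : ∀ {v w : V}, (v ⟶ w) → (H →L[ℂ] H)} (ht : IsRepresentation k t)
include ht

lemma isStarProjection_range {v w : V} (f : v ⟶ w) : IsStarProjection (t f * star (t f)) := by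
  refine ⟨?_, ?_⟩
  · rw [IsIdempotentElem, ← mul_assoc, ht.partial_isometry]
  · rw [isSelfAdjoint_iff, star_mul, star_star]

lemma mul_star_id (v : V) : t (𝟙 v) * star (t (𝟙 v)) = t (𝟙 v) := by
  rw [(ht.ck1_proj v).isSelfAdjoint.star_eq, (ht.ck1_proj v).isIdempotentElem.eq]

lemma range_comp {u v w : V} (f : v ⟶ w) (g : u ⟶ v) :
    t (g ≫ f) * star (t (g ≫ f)) = t f * (t g * star (t g)) * star (t f) := by
  rw [← ht.ck2, star_mul]
  simp only [mul_assoc]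

/-- Conjugate the relation `ck4` at the source of f by t_f. -/
lemma range_eq_sum {v w : V} (f : v ⟶ w) (n : Fin k → ℕ)
    [Fintype (PathsTo (k := k) v n)] :
    t f * star (t f) = ∑ g : PathsTo v n, t (g.1.2 ≫ f) * star (t (g.1.2 ≫ f)) := by
  have h := ht.ck4 v n
  rw [finsum_eq_sum_of_fintype] at h
  simp only [ht.range_comp]
  rw [← Finset.sum_mul, ← Finset.mul_sum, ← h, ht.ck2, Category.id_comp]

lemma exists_measure (hfin : IsFinite k V) (hsrc : NoSources k V) (ξ : H) :
    ∃ μ : Measure (InfinitePath k V), ∀ {v w : V} (f : v ⟶ w),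
      μ (cylinder f) = ENNReal.ofReal (‖(t f * star (t f)) ξ‖ ^ 2) := by
  refine exists_measure_of_weights hfin hsrc
    (fun a => ENNReal.ofReal (‖(t a.hom * star (t a.hom)) ξ‖ ^ 2)) ?_
  intro v w f n
  have := finite_pathsTo hfin v n
  have := Fintype.ofFinite (PathsTo (k := k) v n)
  rw [tsum_fintype, ← ENNReal.ofReal_sum_of_nonneg fun _ _ => sq_nonneg _]
  congr 1
  simp only [← (ht.isStarProjection_range _).re_inner_apply_self]
  rw [← Complex.re_sum, ← inner_sum]
  congr 2
  exact ((congrArg (fun T : H →L[ℂ] H => T ξ) (ht.range_eq_sum f n)).trans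
    (_root_.sum_apply _ _ _)).symm

lemma exists_projectionValuedMeasure (hfin : IsFinite k V) (hsrc : NoSources k V) :
    ∃ P : ProjectionValuedMeasure (InfinitePath k V) H, IsProjectionValuedMeasureOf t P := by
  have := countable_paths (k := k) (V := V)
  have : Countable V :=
    Function.Injective.countable (f := fun v : V => Arrow.mk (𝟙 v)) fun _ _ h =>
      congrArg Arrow.left h
  choose μ hμ using fun ξ => ht.exists_measure hfin hsrc ξ
  have hcyl : ∀ {v w : V} (f : v ⟶ w), IsProjectionOfSet μ (cylinder f) (t f * star (t f)) :=
    fun f => ⟨ht.isStarProjection_range f, fun ξ => hμ ξ f⟩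
  obtain ⟨P, hP⟩ := ProjectionValuedMeasure.exists_of_isProjectionOfSet (μ := μ)
    borel_eq_generateFrom_diagonalCylinders isPiSystem_diagonalCylinders (by
      obtain ⟨T, hT, -⟩ := IsProjectionOfSet.iUnion_of_mul_eq_zero (μ := μ)
        (fun v : V => measurableSet_cylinder (k := k) (𝟙 v))
        (fun v w hvw => cylinder_disjoint (by rw [degree_id, degree_id])
          fun h => hvw (congrArg Arrow.left h))
        (fun v => hcyl (𝟙 v))
        (fun v w hvw => by
          beta_reduce
          rw [ht.mul_star_id, ht.mul_star_id, ht.ck1_orth v w hvw])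
      rw [iUnion_cylinder_id] at hT
      exact ⟨T, hT⟩) (by
      rintro _ ⟨v, w, f, n, -, rfl⟩
      exact ⟨_, hcyl f⟩)
  exact ⟨P, fun f => (hP _ (measurableSet_cylinder f)).unique (hcyl f)⟩

lemma quadraticMeasure_cylinder {P : ProjectionValuedMeasure (InfinitePath k V) H}
    (hP : IsProjectionValuedMeasureOf t P) (ξ : H) : IsMeasureOf t ξ (P.quadraticMeasure ξ) := by
  intro v w f
  rw [P.quadraticMeasure_apply ξ (measurableSet_cylinder f), hP f,
    (ht.isStarProjection_range f).re_inner_apply_self]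

lemma projectionValuedMeasure_unique {P Q : ProjectionValuedMeasure (InfinitePath k V) H}
    (hP : IsProjectionValuedMeasureOf t P) (hQ : IsProjectionValuedMeasureOf t Q) : P = Q := by
  refine ProjectionValuedMeasure.ext_of_measurableSet fun A hA => ?_
  refine (P.isStarProjection A hA).ext_of_norm (Q.isStarProjection A hA) fun ξ => ?_
  have h := congrArg (fun μ : Measure (InfinitePath k V) => μ A) (IsMeasureOf.unique
    (ht.quadraticMeasure_cylinder hP ξ) (ht.quadraticMeasure_cylinder hQ ξ))
  simp only [P.quadraticMeasure_apply ξ hA, Q.quadraticMeasure_apply ξ hA] at h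
  rw [ENNReal.ofReal_eq_ofReal_iff (by positivity) (by positivity)] at h
  exact (pow_left_inj₀ (norm_nonneg _) (norm_nonneg _) two_ne_zero).1 h

end IsRepresentation

end Representation

end KGraph

/-! ### Atoms of a projection valued measure. -/

namespace ProjectionValuedMeasure

variable {X : Type*} [MeasurableSpace X] {H : Type*} [NormedAddCommGroup H]
  [InnerProductSpace ℂ H] [CompleteSpace H] (P : ProjectionValuedMeasure X H)

lemma apply_singleton_of_mem [MeasurableSingletonClass X] {A : Set X} (hA : MeasurableSet A)
    {x : X} (hx : x ∈ A) (ξ : H) : P.toFun {x} (P.toFun A ξ) = P.toFun {x} ξ := by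
  rw [P.apply_apply (measurableSet_singleton x) hA,
    Set.inter_eq_left.2 (Set.singleton_subset_iff.2 hx)]

lemma apply_singleton_of_notMem [MeasurableSingletonClass X] {A : Set X} (hA : MeasurableSet A)
    {x : X} (hx : x ∉ A) (ξ : H) : P.toFun {x} (P.toFun A ξ) = 0 := by
  rw [P.apply_apply (measurableSet_singleton x) hA, Set.singleton_inter_eq_empty.2 hx, P.empty]
  rfl

/-- The set of atoms of a purely atomic projection valued measure is countable. -/
lemma countable_of_hasSum [TopologicalSpace.SeparableSpace H] {Ω : Set X}
    (hne : ∀ ω ∈ Ω, P.toFun {ω} ≠ 0)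
    (hsum : ∀ ξ : H, HasSum (fun ω : Ω => P.toFun {(ω : X)} ξ) ξ) : Ω.Countable := by
  obtain ⟨D, hDc, hD⟩ := TopologicalSpace.exists_countable_dense H
  have hcount : (⋃ ξ ∈ D, Function.support fun ω : Ω => P.toFun {(ω : X)} ξ).Countable :=
    hDc.biUnion fun ξ _ => (hsum ξ).summable.countable_support
  rw [← Set.countable_coe_iff, ← Set.countable_univ_iff]
  refine hcount.mono fun ω _ => ?_
  by_contra h
  simp only [Set.mem_iUnion, Function.mem_support, not_exists, not_not] at h
  -- An atom outside the countable union of supports would annihilate a dense set, hence be zero.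
  refine hne ω ω.2 (ContinuousLinearMap.coeFn_injective ?_)
  exact (P.toFun {(ω : X)}).continuous.ext_on hD continuous_const fun ξ hξ => h ξ hξ

/-- A countable family of atoms admits a vector that no atom annihilates. -/
lemma exists_apply_singleton_ne_zero [MeasurableSingletonClass X] {Ω : Set X} (hΩ : Ω.Countable)
    (hne : ∀ ω ∈ Ω, P.toFun {ω} ≠ 0) : ∃ ξ : H, ∀ ω ∈ Ω, P.toFun {ω} ξ ≠ 0 := by
  have := hΩ.to_subtype
  have := Encodable.ofCountable Ω
  have hη : ∀ ω : Ω, ∃ u : H, ‖u‖ = 1 ∧ P.toFun {(ω : X)} u = u := by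
    intro ω
    obtain ⟨η, hη⟩ : ∃ η, P.toFun {(ω : X)} η ≠ 0 := by
      by_contra! h
      exact hne ω ω.2 (ContinuousLinearMap.ext h)
    refine ⟨(‖P.toFun {(ω : X)} η‖⁻¹ : ℂ) • P.toFun {(ω : X)} η, ?_, ?_⟩
    · rw [norm_smul, norm_inv, Complex.norm_real, norm_norm, inv_mul_cancel₀ (norm_ne_zero_iff.2 hη)]
    · rw [map_smul, P.apply_singleton_of_mem (measurableSet_singleton _) rfl]
  choose u hu1 hu2 using hη
  have hs : Summable fun ω : Ω => ((1 / 2 : ℝ) ^ Encodable.encode ω : ℂ) • u ω := by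
    refine Summable.of_norm ?_
    simpa [norm_smul, hu1] using summable_geometric_two_encode (ι := Ω)
  refine ⟨∑' ω : Ω, ((1 / 2 : ℝ) ^ Encodable.encode ω : ℂ) • u ω, fun ω hω h => ?_⟩
  rw [(P.toFun {ω}).map_tsum hs, tsum_eq_single ⟨ω, hω⟩] at h
  · rw [map_smul, hu2 ⟨ω, hω⟩] at h
    have h1 : u ⟨ω, hω⟩ = 0 := (smul_eq_zero.1 h).resolve_left (pow_ne_zero _ (by norm_num))
    have h2 := hu1 ⟨ω, hω⟩
    rw [h1, norm_zero] at h2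
    exact zero_ne_one h2
  · intro ω' hne'
    rw [map_smul, ← hu2 ω', P.apply_singleton_of_notMem (measurableSet_singleton _), smul_zero]
    exact fun h => hne' (Subtype.ext h.symm)

end ProjectionValuedMeasure

/-! ### Cyclic vectors and rank-one atoms. -/

namespace KGraph

variable {k : ℕ} {V : Type u} [SmallCategory V] [KGraph k V]
variable {H : Type*} [NormedAddCommGroup H] [InnerProductSpace ℂ H] [CompleteSpace H]
variable {t : ∀ {v w : V}, (v ⟶ w) → (H →L[ℂ] H)}
variable {P : ProjectionValuedMeasure (InfinitePath k V) H}

lemma finrank_range_eq_one_of_isCyclicVector (hP : IsProjectionValuedMeasureOf t P) {ξ : H}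
    (hξ : IsCyclicVector t ξ) {x : InfinitePath k V} (hx : P.toFun {x} ≠ 0) :
    Module.finrank ℂ (P.toFun {x}).range = 1 := by
  have hmem : ∀ η, P.toFun {x} η ∈ Submodule.span ℂ {P.toFun {x} ξ} := by
    intro η
    -- The vectors sent into the line of P({x})ξ form a closed subspace, so it suffices to test the
    -- spanning vectors.
    have hclosed : IsClosed ((Submodule.span ℂ {P.toFun {x} ξ}).comap
        (P.toFun {x} : H →ₗ[ℂ] H) : Set H) :=
      (Submodule.closed_of_finiteDimensional (Submodule.span ℂ {P.toFun {x} ξ})).preimage (P.toFun {x}).continuous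
    have hle := Submodule.topologicalClosure_minimal (Submodule.span ℂ
      {η : H | ∃ (v w : V) (f : v ⟶ w), η = (t f * star (t f)) ξ})
      (Submodule.span_le.2 ?_) hclosed
    · rw [hξ] at hle
      exact hle Submodule.mem_top
    · rintro _ ⟨v, w, f, rfl⟩
      change P.toFun {x} ((t f * star (t f)) ξ) ∈ Submodule.span ℂ {P.toFun {x} ξ}
      rw [← hP f]
      by_cases hxf : x ∈ (cylinder f : Set (InfinitePath k V))
      · rw [P.apply_singleton_of_mem (measurableSet_cylinder f) hxf]
        exact Submodule.mem_span_singleton_self _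
      · rw [P.apply_singleton_of_notMem (measurableSet_cylinder f) hxf]
        exact Submodule.zero_mem _
  have hrange : (P.toFun {x}).range = Submodule.span ℂ {P.toFun {x} ξ} := by
    apply le_antisymm
    · rintro _ ⟨η, rfl⟩
      exact hmem η
    · rw [Submodule.span_singleton_le_iff_mem]
      exact ⟨ξ, rfl⟩
  have hne : P.toFun {x} ξ ≠ 0 := by
    intro h
    refine hx (ContinuousLinearMap.ext fun η => ?_)
    have := hmem η
    rw [h, Submodule.span_zero_singleton] at this
    exact this
  rw [hrange]
  exact finrank_span_singleton hne

lemma apply_singleton_mem_closure_span (hP : IsProjectionValuedMeasureOf t P) (ξ : H)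
    (x : InfinitePath k V) : P.toFun {x} ξ ∈ (Submodule.span ℂ
      {η : H | ∃ (v w : V) (f : v ⟶ w), η = (t f * star (t f)) ξ}).topologicalClosure := by
  have h := P.tendsto_iInter (fun _ => measurableSet_cylinder _) (antitone_cylinder_initial x) ξ
  rw [iInter_cylinder_initial] at h
  refine (Submodule.isClosed_topologicalClosure _).mem_of_tendsto h
    (Filter.Eventually.of_forall fun n => ?_)
  rw [hP]
  exact Submodule.le_topologicalClosure _ (Submodule.subset_span ⟨_, _, _, rfl⟩)

lemma exists_isCyclicVector [TopologicalSpace.SeparableSpace H]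
    (hP : IsProjectionValuedMeasureOf t P) (hat : P.IsPurelyAtomic)
    (hone : ∀ x, P.toFun {x} ≠ 0 → Module.finrank ℂ (P.toFun {x}).range = 1) :
    ∃ ξ : H, IsCyclicVector t ξ := by
  obtain ⟨Ω, -, -, hne, hsum⟩ := hat
  obtain ⟨ξ, hξ⟩ := P.exists_apply_singleton_ne_zero (P.countable_of_hasSum hne hsum) hne
  refine ⟨ξ, (Submodule.eq_top_iff'.2 fun η => ?_)⟩
  refine (Submodule.isClosed_topologicalClosure _).mem_of_tendsto (hsum η)
    (Filter.Eventually.of_forall fun F => Submodule.sum_mem _ fun ω _ => ?_)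
  -- In a one-dimensional range the nonzero vector P({ω})ξ spans, so P({ω})η is a multiple of it.
  obtain ⟨c, hc⟩ := exists_smul_eq_of_finrank_eq_one (hone ω (hne ω ω.2))
    (x := (⟨P.toFun {(ω : InfinitePath k V)} ξ, ξ, rfl⟩ : (P.toFun {(ω : InfinitePath k V)}).range))
    (fun h => hξ ω ω.2 (congrArg Subtype.val h)) ⟨P.toFun {(ω : InfinitePath k V)} η, η, rfl⟩
  have hc' : c • P.toFun {(ω : InfinitePath k V)} ξ = P.toFun {(ω : InfinitePath k V)} η :=
    congrArg Subtype.val hc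
  rw [← hc']
  exact Submodule.smul_mem _ _ (apply_singleton_mem_closure_span hP ξ ω)

lemma isAtomicMeasure_quadraticMeasure [TopologicalSpace.SeparableSpace H]
    (hat : P.IsPurelyAtomic) (ξ : H) : IsAtomicMeasure (P.quadraticMeasure ξ) := by
  obtain ⟨Ω, hΩ, hcompl, hne, hsum⟩ := hat
  have hc := P.countable_of_hasSum hne hsum
  have h1 : P.quadraticMeasure ξ Ωᶜ = 0 := by
    rw [P.quadraticMeasure_apply ξ hΩ.compl, hcompl]
    simp
  have h2 : P.quadraticMeasure ξ (⋃ x ∈ {x ∈ Ω | P.quadraticMeasure ξ {x} = 0}, {x}) = 0 :=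
    (measure_biUnion_null_iff (hc.mono (Set.sep_subset _ _))).2 fun x hx => hx.2
  refine measure_mono_null ?_ (measure_union_null h1 h2)
  intro x hx
  by_cases hxΩ : x ∈ Ω
  · exact Or.inr (Set.mem_biUnion ⟨hxΩ, hx⟩ rfl)
  · exact Or.inl hxΩ

end KGraph

theorem mainTheorem10 (k : ℕ) (V : Type u) [SmallCategory V] [KGraph k V]
    (hfin : KGraph.IsFinite k V) (hsrc : KGraph.NoSources k V)
    (H : Type*) [NormedAddCommGroup H] [InnerProductSpace ℂ H] [CompleteSpace H]
    [TopologicalSpace.SeparableSpace H]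
    (t : ∀ {v w : V}, (v ⟶ w) → (H →L[ℂ] H))
    (ht : KGraph.IsRepresentation k t)
    (hne : ∀ {v w : V} (f : v ⟶ w), t f * star (t f) ≠ 0) :
    (∃! P : ProjectionValuedMeasure (KGraph.InfinitePath k V) H,
      KGraph.IsProjectionValuedMeasureOf t P) ∧
    ∀ P : ProjectionValuedMeasure (KGraph.InfinitePath k V) H,
      KGraph.IsProjectionValuedMeasureOf t P → P.IsPurelyAtomic →
      (KGraph.IsMonic t ↔
        ∀ x : KGraph.InfinitePath k V, P.toFun {x} ≠ 0 →
          Module.finrank ℂ (P.toFun {x}).range = 1) ∧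
      (KGraph.IsMonic t → ∀ ξ : H, KGraph.IsCyclicVector t ξ →
        (∃! μ : Measure (KGraph.InfinitePath k V), KGraph.IsMeasureOf t ξ μ) ∧
        ∀ μ : Measure (KGraph.InfinitePath k V), KGraph.IsMeasureOf t ξ μ →
          IsAtomicMeasure μ) := by
  refine ⟨?_, fun P hP hat => ⟨⟨?_, fun hone => ⟨?_, ?_⟩⟩, fun _ ξ _ => ⟨?_, fun μ hμ => ?_⟩⟩⟩
  · obtain ⟨P, hP⟩ := ht.exists_projectionValuedMeasure hfin hsrc
    exact ⟨P, hP, fun Q hQ => ht.projectionValuedMeasure_unique hQ hP⟩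
  · rintro ⟨-, ξ, hξ⟩ x hx
    exact KGraph.finrank_range_eq_one_of_isCyclicVector hP hξ hx
  · intro v w f h
    have h' : t f = 0 := h
    exact hne f (by rw [h', zero_mul])
  · exact KGraph.exists_isCyclicVector hP hat hone
  · exact ⟨_, ht.quadraticMeasure_cylinder hP ξ, fun ν hν =>
      KGraph.IsMeasureOf.unique hν (ht.quadraticMeasure_cylinder hP ξ)⟩
  · rw [KGraph.IsMeasureOf.unique hμ (ht.quadraticMeasure_cylinder hP ξ)]
    exact KGraph.isAtomicMeasure_quadraticMeasure hat ξ
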